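/- All groups are finite, and a class of finite groups is understood to be closed under isomorphism. A *formation* is a class $\mathfrak F$ of finite groups closed under homomorphic images and subdirect products. It is *hereditary* if every subgroup of a group in $\mathfrak F$ belongs to $\mathfrak F$, and *2-recognizable* if a finite group $G$ belongs to $\mathfrak F$ whenever $\langle a,b\rangle\in\mathfrak F$ for all $a,b\in G$. For a finite group $G$ let $\widetilde\Gamma_{\mathfrak F}(G)$ be the graph with vertex set $G$ in which two distinct vertices $g,h$ are adjacent if and only if $\langle g,h\rangle\notin\mathfrak F$, let $\mathcal I_{\mathfrak F}(G)$ be the set of its isolated vertices, and let $\Gamma_{\mathfrak F}(G)$ be the graph obtained from $\widetilde\Gamma_{\mathfrak F}(G)$ by deleting the vertices in $\mathcal I_{\mathfrak F}(G)$. The formation $\mathfrak F$ is *semiregular* if $\mathcal I_{\mathfrak F}(G)$ is a subgroup of $G$ for every finite group $G$. A graph is *planar* if it can be drawn in the plane so that its edges intersect only at their ends. **Theorem.** Let $\mathfrak F$ be a 2-recognizable, hereditary, semiregular formation containing all finite nilpotent groups, and let $G$ be a finite group. Then $\Gamma_{\mathfrak F}(G)$ is planar if and only if either $G\in\mathfrak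 F$ or $G\cong S_3$. -/

import Mathlib

universe u

/-- A class of finite groups: a property of groups which only finite groups may have and which
is invariant under isomorphism. -/
structure FiniteGroupClass where
  /-- `Mem G` says that the group `G` belongs to the class. -/
  Mem : (G : Type u) → [Group G] → Prop
  finite_of_mem : ∀ (G : Type u) [Group G], Mem G → Finite G
  mem_of_mulEquiv : ∀ (G H : Type u) [Group G] [Group H], Nonempty (G ≃* H) → Mem G → Mem H

namespace FiniteGroupClass

variable (F : FiniteGroupClass.{u})

/-- A formation: a class of finite groups closed under homomorphic images and under subdirect
products (subgroups of a direct product that project onto both factors). -/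
structure IsFormation : Prop where
  mem_of_surjective : ∀ (G H : Type u) [Group G] [Group H] (f : G →* H),
    Function.Surjective f → F.Mem G → F.Mem H
  mem_subdirect : ∀ (G₁ G₂ : Type u) [Group G₁] [Group G₂] (H : Subgroup (G₁ × G₂)),
    F.Mem G₁ → F.Mem G₂ →
    Function.Surjective (fun h : H => (h : G₁ × G₂).1) →
    Function.Surjective (fun h : H => (h : G₁ × G₂).2) → F.Mem H

/-- The class is closed under taking subgroups. -/
def IsHereditary : Prop :=
  ∀ (G : Type u) [Group G] (H : Subgroup G), F.Mem G → F.Mem H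

/-- A finite group belongs to the class as soon as all its 2-generated subgroups do. -/
def IsTwoRecognizable : Prop :=
  ∀ (G : Type u) [Group G] [Finite G],
    (∀ a b : G, F.Mem (Subgroup.closure ({a, b} : Set G))) → F.Mem G

/-- The graph on all elements of `G` in which two distinct elements are adjacent iff the subgroup
they generate is not in the class. -/
def fullGraph (G : Type u) [Group G] : SimpleGraph G where
  Adj g h := g ≠ h ∧ ¬ F.Mem (Subgroup.closure ({g, h} : Set G))
  symm := ⟨fun g h ⟨hne, hF⟩ => ⟨hne.symm, by rwa [Set.pair_comm]⟩⟩
  loopless := ⟨fun _ h => h.1 rfl⟩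

/-- The set of isolated vertices of the graph `fullGraph`. -/
def isolated (G : Type u) [Group G] : Set G :=
  {g | (F.fullGraph G).IsIsolated g}

/-- The non-`F` graph of `G`: the graph `fullGraph` with its isolated vertices deleted. -/
def nonGraph (G : Type u) [Group G] : SimpleGraph ((F.isolated G)ᶜ : Set G) :=
  (F.fullGraph G).induce (F.isolated G)ᶜ

/-- In every finite group the isolated vertices form a subgroup. -/
def IsSemiregular : Prop :=
  ∀ (G : Type u) [Group G] [Finite G], ∃ H : Subgroup G, (H : Set G) = F.isolated G

/-- The class contains all finite nilpotent groups. -/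
def ContainsNilpotent : Prop :=
  ∀ (G : Type u) [Group G] [Finite G], Group.IsNilpotent G → F.Mem G

end FiniteGroupClass

/-- A drawing of a simple graph in the Euclidean plane: vertices are distinct points, every edge is
a simple arc joining its two ends, and edges meet vertices and each other only at their ends. -/
structure PlaneDrawing {V : Type u} (Γ : SimpleGraph V) where
  point : V → EuclideanSpace ℝ (Fin 2)
  point_injective : Function.Injective point
  arc : Γ.edgeSet → unitInterval → EuclideanSpace ℝ (Fin 2)
  arc_continuous : ∀ e, Continuous (arc e)
  arc_injective : ∀ e, Function.Injective (arc e)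
  /-- The unordered pair of end points of the arc of `e` is the pair of ends of `e`. -/
  arc_ends : ∀ e, s(arc e 0, arc e 1) = Sym2.map point (e : Sym2 V)
  /-- No vertex lies in the interior of an arc. -/
  arc_ne_point : ∀ e (t : unitInterval), 0 < t → t < 1 → ∀ v, arc e t ≠ point v
  /-- An interior point of an arc lies on no other arc. -/
  arc_ne_arc : ∀ e e' (t t' : unitInterval), e ≠ e' → 0 < t → t < 1 → arc e t ≠ arc e' t'

/-- A graph is planar if it can be drawn in the plane so that its edges intersect only at their
ends. -/
def IsPlanarGraph {V : Type u} (Γ : SimpleGraph V) : Prop :=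
  Nonempty (PlaneDrawing Γ)

/-! A planar graph contains no `K₃,₃`, and in a group outside the class too many pairs generate
non-members to avoid one. If `⟨g, h⟩` is a non-member and `g² ≠ 1`, then `h` inverts `g`
(`NonMem.inverts`), and `h` is an involution because otherwise `⟨g, h⟩` would be nilpotent. So every
such pair generates a dihedral group, whose rotation must have order 3 (`NonMem.rotation_cube`).

Semiregularity makes the isolated vertices a normal subgroup `N`. A nontrivial element of `N` would
duplicate vertices inside cosets and again give `K₃,₃`, so `N = 1` (`isolated_eq_bot_of_planar`).
Now all element orders are at most 3 and distinct involutions never commute, so any two of them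
generate a copy of `S₃` outside the class. An involution outside one such copy would yield a last
`K₃,₃` (`closure_eq_top_of_planar`), hence `G ≅ S₃`.

Conversely, the graph has no vertices for a member, and for `S₃` it embeds in a triangular
bipyramid. The nonplanarity of `K₃,₃` is a parity count of winding numbers
(`no_arc_system_threeThree`). -/

/-! ### Nonplanarity of `K₃,₃` by continuous logarithms. -/

open Complex in
/-- A nowhere vanishing continuous function on the plane has a continuous logarithm. -/
theorem exists_continuous_log_plane {f : ℝ × ℝ → ℂ} (hf : Continuous f) (h0 : ∀ x, f x ≠ 0) :
    ∃ L : ℝ × ℝ → ℂ, Continuous L ∧ ∀ x, exp (L x) = f x := by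
  let g : C(ℝ × ℝ, {z : ℂ // z ≠ 0}) := ⟨fun x => ⟨f x, h0 x⟩, by fun_prop⟩
  obtain ⟨L, ⟨-, hL⟩, -⟩ := isCoveringMap_exp.existsUnique_continuousMap_lifts g
    0 (log (f 0)) (by simp [g, exp_log (h0 0)])
  exact ⟨L, L.continuous, fun x => congrArg Subtype.val (congrFun hL x)⟩

open Complex in
/-- Two continuous logarithms of the same function along a line have the same increments. -/
theorem log_increment_eq {L M : ℝ → ℂ} (hL : Continuous L) (hM : Continuous M)
    (h : ∀ t, exp (L t) = exp (M t)) : L 1 - L 0 = M 1 - M 0 := by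
  have key := isCoveringMap_exp.eq_of_comp_eq (g₁ := fun t => L t - L 0 + M 0) (g₂ := M)
    (by fun_prop) hM (by
      funext t
      apply Subtype.ext
      simp [exp_add, exp_sub, h]) 0 (by simp)
  have := congrFun key 1
  rw [← this]; ring

open Complex in
/-- There is a function giving the increment over `[0,1]` of a continuous logarithm. -/
theorem exists_log_increment : ∃ Δ : (ℝ → ℂ) → ℂ,
    (∀ f, Continuous f → (∀ t, f t ≠ 0) → exp (Δ f) = f 1 / f 0) ∧
    (∀ f L : ℝ → ℂ, Continuous L → (∀ t, exp (L t) = f t) → Δ f = L 1 - L 0) := by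
  classical
  let Δ : (ℝ → ℂ) → ℂ := fun f =>
    if h : ∃ L : ℝ → ℂ, Continuous L ∧ ∀ t, exp (L t) = f t then h.choose 1 - h.choose 0 else 0
  have hΔ : ∀ f L : ℝ → ℂ, Continuous L → (∀ t, exp (L t) = f t) → Δ f = L 1 - L 0 := by
    intro f L hL hf
    have h : ∃ L : ℝ → ℂ, Continuous L ∧ ∀ t, exp (L t) = f t := ⟨L, hL, hf⟩
    simp only [Δ, dif_pos h]
    exact log_increment_eq h.choose_spec.1 hL fun t => by rw [h.choose_spec.2, hf]
  refine ⟨Δ, fun f hf h0 => ?_, hΔ⟩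
  obtain ⟨L, hL, hLf⟩ := exists_continuous_log_plane (f := fun x => f x.1) (by fun_prop)
    (fun x => h0 _)
  rw [hΔ f (fun t => L (t, 0)) (by fun_prop) (fun t => hLf _), exp_sub, hLf, hLf]

open Complex in
/-- For disjoint arcs `α`, `β`, the turning of `α` seen from the ends of `β` and that of `β` seen
from the ends of `α` balance. -/
theorem log_increment_square {Δ : (ℝ → ℂ) → ℂ}
    (hΔ : ∀ f L : ℝ → ℂ, Continuous L → (∀ t, exp (L t) = f t) → Δ f = L 1 - L 0)
    {α β : ℝ → ℂ} (hα : Continuous α) (hβ : Continuous β) (h : ∀ s t, α s ≠ β t) :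
    Δ (fun s => α s - β 0) + Δ (fun t => β t - α 1) =
      Δ (fun t => β t - α 0) + Δ (fun s => α s - β 1) := by
  -- One logarithm of `α s - β t` on the whole square: both sides are its increment from `(0,0)` to
  -- `(1,1)`, along the two boundary paths. The shifts by `πi` turn `α - β` into `β - α`.
  obtain ⟨L, hL, hLf⟩ := exists_continuous_log_plane (f := fun x => α x.1 - β x.2) (by fun_prop)
    (fun x => sub_ne_zero.2 (h _ _))
  rw [hΔ _ (fun s => L (s, 0)) (by fun_prop) (fun t => hLf _),
    hΔ _ (fun s => L (s, 1)) (by fun_prop) (fun t => hLf _),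
    hΔ _ (fun t => L (1, t) + Real.pi * I) (by fun_prop) (fun t => by
      rw [exp_add, hLf, exp_pi_mul_I]; ring),
    hΔ _ (fun t => L (0, t) + Real.pi * I) (by fun_prop) (fun t => by
      rw [exp_add, hLf, exp_pi_mul_I]; ring)]
  ring

/-- Three points cannot be joined to three further points by arcs in the plane such that arcs
without a common end are disjoint. -/
theorem no_arc_system_threeThree (p q : Fin 3 → ℂ) (hp : Function.Injective p)
    (hq : Function.Injective q) (hpq : ∀ i j, p i ≠ q j)
    (γ : Fin 3 → Fin 3 → ℝ → ℂ) (hγ : ∀ i j, Continuous (γ i j)) (h0 : ∀ i j, γ i j 0 = p i)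
    (h1 : ∀ i j, γ i j 1 = q j)
    (hd : ∀ i j k l, i ≠ k → j ≠ l → ∀ s t, γ i j s ≠ γ k l t) : False := by
  obtain ⟨Δ, hexp, hΔ⟩ := exists_log_increment
  -- The branches are fixed so that `P k i - P i k = πi` exactly when `i < k`, and likewise for `Q`.
  set P : Fin 3 → Fin 3 → ℂ := fun i k =>
    if i < k then Complex.log (p i - p k) else Complex.log (p k - p i) + Real.pi * Complex.I
  set Q : Fin 3 → Fin 3 → ℂ := fun j l =>
    if j < l then Complex.log (q j - q l) else Complex.log (q l - q j) + Real.pi * Complex.I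
  set U : Fin 3 → Fin 3 → ℂ := fun i j => Complex.log (q j - p i)
  have hP : ∀ i k, i ≠ k → Complex.exp (P i k) = p i - p k := by
    intro i k h
    have h1 := sub_ne_zero.2 (hp.ne h)
    have h2 := sub_ne_zero.2 (hp.ne h.symm)
    simp only [P]
    split_ifs
    · rw [Complex.exp_log h1]
    · rw [Complex.exp_add, Complex.exp_log h2, Complex.exp_pi_mul_I]; ring
  have hQ : ∀ i k, i ≠ k → Complex.exp (Q i k) = q i - q k := by
    intro i k h
    have h1 := sub_ne_zero.2 (hq.ne h)
    have h2 := sub_ne_zero.2 (hq.ne h.symm)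
    simp only [Q]
    split_ifs
    · rw [Complex.exp_log h1]
    · rw [Complex.exp_add, Complex.exp_log h2, Complex.exp_pi_mul_I]; ring
  have hU : ∀ i j, Complex.exp (U i j) = q j - p i := fun i j =>
    Complex.exp_log (sub_ne_zero.2 (hpq i j).symm)
  have third : ∀ j : Fin 3, ∃ l, j ≠ l := by decide
  -- The integer depends only on the arc and on the vertex from which it is seen, not on the second
  -- arc; the parity count rests on this. The point `p k` is off the arc because it starts another
  -- arc disjoint from it, which is why `third` is needed.
  have hA : ∀ k i j, ∃ n : ℤ, k ≠ i →
      Δ (fun s => γ i j s - p k) = U k j - P i k + n * (2 * Real.pi * Complex.I) := by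
    intro k i j
    by_cases hki : k = i
    · exact ⟨0, fun h => absurd hki h⟩
    obtain ⟨l, hl⟩ := third j
    obtain ⟨n, hn⟩ := Complex.exp_eq_exp_iff_exists_int.1
      (show Complex.exp (Δ (fun s => γ i j s - p k)) = Complex.exp (U k j - P i k) by
        rw [hexp (fun s => γ i j s - _) ((hγ i j).sub continuous_const) (fun t => by
          rw [← h0 k l]; exact sub_ne_zero.2 (hd i j k l (Ne.symm hki) hl _ _)),
          Complex.exp_sub, hU, hP _ _ (Ne.symm hki), h0, h1])
    exact ⟨n, fun _ => hn⟩
  have hB : ∀ l i j, ∃ n : ℤ, l ≠ j →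
      Δ (fun s => γ i j s - q l) =
        Q j l - (U i l + Real.pi * Complex.I) + n * (2 * Real.pi * Complex.I) := by
    intro l i j
    by_cases hlj : l = j
    · exact ⟨0, fun h => absurd hlj h⟩
    obtain ⟨k, hk⟩ := third i
    obtain ⟨n, hn⟩ := Complex.exp_eq_exp_iff_exists_int.1
      (show Complex.exp (Δ (fun s => γ i j s - q l)) =
          Complex.exp (Q j l - (U i l + Real.pi * Complex.I)) by
        rw [hexp (fun s => γ i j s - _) ((hγ i j).sub continuous_const) (fun t => by
          rw [← h1 k l]; exact sub_ne_zero.2 (hd i j k l hk (Ne.symm hlj) _ _)),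
          Complex.exp_sub, hQ _ _ (Ne.symm hlj), Complex.exp_add, hU, Complex.exp_pi_mul_I, h0, h1]
        congr 1; ring)
    exact ⟨n, fun _ => hn⟩
  choose a ha using hA
  choose b hb using hB
  have hc : (2 * Real.pi * Complex.I : ℂ) ≠ 0 := Complex.two_pi_I_ne_zero
  have hE : ∀ i j k l, i ≠ k → j ≠ l →
      -P i k + P k i + Q l j - Q j l +
        (a k i j + b j k l - a i k l - b l i j : ℤ) * (2 * Real.pi * Complex.I) = 0 := by
    intro i j k l hik hjl
    have := log_increment_square hΔ (hγ i j) (hγ k l) (hd i j k l hik hjl)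
    rw [h0, h0, h1, h1, ha k i j hik.symm, hb j k l hjl, ha i k l hik, hb l i j hjl.symm] at this
    push_cast
    linear_combination this
  have hodd : ∀ i j k l, i < k → j < l → a k i j + b j k l - a i k l - b l i j = -1 := by
    intro i j k l hik hjl
    have := hE i j k l hik.ne hjl.ne
    simp only [P, Q, if_pos hik, if_pos hjl, if_neg hik.not_gt, if_neg hjl.not_gt] at this
    have h2 : ((a k i j + b j k l - a i k l - b l i j : ℤ) + 1 : ℂ) * (2 * Real.pi * Complex.I)
      = 0 := by linear_combination this
    have h3 := (mul_eq_zero.1 h2).resolve_right hc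
    have h4 : (a k i j + b j k l - a i k l - b l i j : ℤ) + 1 = 0 := by exact_mod_cast h3
    omega
  have heven : ∀ i j k l, i < k → l < j → a k i j + b j k l - a i k l - b l i j = 0 := by
    intro i j k l hik hjl
    have := hE i j k l hik.ne hjl.ne'
    simp only [P, Q, if_pos hik, if_pos hjl, if_neg hik.not_gt, if_neg hjl.not_gt] at this
    have h2 : ((a k i j + b j k l - a i k l - b l i j : ℤ) : ℂ) * (2 * Real.pi * Complex.I)
      = 0 := by linear_combination this
    exact_mod_cast (mul_eq_zero.1 h2).resolve_right hc
  -- There is one equation for each of the 18 pairs of disjoint edges. In their sum every integer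
  -- occurs twice, once for each edge at the observing vertex that is disjoint from the arc, so the
  -- left side is even, while the right side is `-9`.
  have l01 : (0 : Fin 3) < 1 := by decide
  have l02 : (0 : Fin 3) < 2 := by decide
  have l12 : (1 : Fin 3) < 2 := by decide
  have e1 := hodd _ _ _ _ l01 l01
  have e2 := hodd _ _ _ _ l01 l02
  have e3 := hodd _ _ _ _ l01 l12
  have e4 := hodd _ _ _ _ l02 l01
  have e5 := hodd _ _ _ _ l02 l02
  have e6 := hodd _ _ _ _ l02 l12
  have e7 := hodd _ _ _ _ l12 l01
  have e8 := hodd _ _ _ _ l12 l02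
  have e9 := hodd _ _ _ _ l12 l12
  have f1 := heven _ _ _ _ l01 l01
  have f2 := heven _ _ _ _ l01 l02
  have f3 := heven _ _ _ _ l01 l12
  have f4 := heven _ _ _ _ l02 l01
  have f5 := heven _ _ _ _ l02 l02
  have f6 := heven _ _ _ _ l02 l12
  have f7 := heven _ _ _ _ l12 l01
  have f8 := heven _ _ _ _ l12 l02
  have f9 := heven _ _ _ _ l12 l12
  omega

/-- A drawing oriented along a prescribed edge. -/
theorem PlaneDrawing.exists_oriented_arc {V : Type u} {Γ : SimpleGraph V} (D : PlaneDrawing Γ)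
    {v w : V} (h : Γ.Adj v w) : ∃ σ : unitInterval → unitInterval, Continuous σ ∧
      D.arc ⟨s(v, w), h⟩ (σ 0) = D.point v ∧ D.arc ⟨s(v, w), h⟩ (σ 1) = D.point w := by
  have := D.arc_ends ⟨s(v, w), h⟩
  simp only [Sym2.map_mk, Sym2.eq_iff] at this
  rcases this with ⟨h0, h1⟩ | ⟨h0, h1⟩
  · exact ⟨id, continuous_id, h0, h1⟩
  · exact ⟨unitInterval.symm, unitInterval.continuous_symm, by simpa using h1, by simpa using h0⟩

theorem PlaneDrawing.arc_disjoint {V : Type u} {Γ : SimpleGraph V} (D : PlaneDrawing Γ)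
    {v w x y : V} (h : Γ.Adj v w) (h' : Γ.Adj x y) (hvx : v ≠ x) (hvy : v ≠ y) (hwx : w ≠ x)
    (hwy : w ≠ y) (s t : unitInterval) :
    D.arc ⟨s(v, w), h⟩ s ≠ D.arc ⟨s(x, y), h'⟩ t := by
  have hne : (⟨s(v, w), h⟩ : Γ.edgeSet) ≠ ⟨s(x, y), h'⟩ := by
    simp [Subtype.ext_iff, hvx, hvy]
  have ends : ∀ {a b : V} (hab : Γ.Adj a b) (s : unitInterval), (0 < s ∧ s < 1) ∨
      D.arc ⟨s(a, b), hab⟩ s = D.point a ∨ D.arc ⟨s(a, b), hab⟩ s = D.point b := by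
    intro a b hab s
    have := D.arc_ends ⟨s(a, b), hab⟩
    simp only [Sym2.map_mk, Sym2.eq_iff] at this
    rcases eq_or_lt_of_le (unitInterval.nonneg' (t := s)) with rfl | h0
    · tauto
    rcases eq_or_lt_of_le (unitInterval.le_one' (t := s)) with rfl | h1
    · tauto
    exact Or.inl ⟨h0, h1⟩
  rcases ends h s with ⟨h0, h1⟩ | hs
  · exact D.arc_ne_arc _ _ _ _ hne h0 h1
  rcases ends h' t with ⟨h0, h1⟩ | ht
  · exact (D.arc_ne_arc _ _ _ _ hne.symm h0 h1).symm
  have := D.point_injective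
  rcases hs with hs | hs <;> rcases ht with ht | ht <;> rw [hs, ht] <;> exact this.ne (by assumption)

/-- A planar graph does not contain a complete bipartite graph `K₃,₃`. -/
theorem IsPlanarGraph.not_threeThree {V : Type u} {Γ : SimpleGraph V} (hΓ : IsPlanarGraph Γ)
    (a b : Fin 3 → V) (ha : Function.Injective a) (hb : Function.Injective b)
    (hab : ∀ i j, Γ.Adj (a i) (b j)) : False := by
  obtain ⟨D⟩ := hΓ
  choose σ hσ h0 h1 using fun i j => D.exists_oriented_arc (hab i j)
  let φ : EuclideanSpace ℝ (Fin 2) → ℂ := fun x => ⟨x 0, x 1⟩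
  have hφ : Function.Injective φ := by
    intro x y h
    simp only [φ, Complex.mk.injEq] at h
    ext i
    fin_cases i
    · exact h.1
    · exact h.2
  have hφc : Continuous φ := by
    have : φ = fun x => (x 0 : ℂ) + (x 1 : ℂ) * Complex.I := by
      funext x; simp [φ, Complex.mk_eq_add_mul_I]
    rw [this]; fun_prop
  have hne : ∀ i j, a i ≠ b j := fun i j => (hab i j).ne
  refine no_arc_system_threeThree (fun i => φ (D.point (a i))) (fun j => φ (D.point (b j)))
    (hφ.comp (D.point_injective.comp ha)) (hφ.comp (D.point_injective.comp hb))
    (fun i j => hφ.ne (D.point_injective.ne (hne i j)))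
    -- Each arc is oriented from `a i` to `b j` and extended to the whole line by constants.
    (fun i j t => φ (D.arc ⟨s(a i, b j), hab i j⟩ (σ i j (Set.projIcc 0 1 zero_le_one t))))
    (fun i j => hφc.comp ((D.arc_continuous _).comp ((hσ i j).comp continuous_projIcc)))
    (fun i j => ?_) (fun i j => ?_) (fun i j k l hik hjl s t => hφ.ne ?_)
  · rw [Set.projIcc_left]; exact congrArg φ (h0 i j)
  · rw [Set.projIcc_right]; exact congrArg φ (h1 i j)
  · exact D.arc_disjoint _ _ (ha.ne hik) (hne _ _) (hne _ _).symm (hb.ne hjl) _ _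

-- Straight-line drawings and the triangular bipyramid.

universe v

/-- Planarity passes to graphs that map injectively into a planar graph. -/
theorem IsPlanarGraph.of_injective_hom {V : Type u} {W : Type v} {Γ : SimpleGraph V} {Γ' : SimpleGraph W}
    (h : IsPlanarGraph Γ') (f : Γ →g Γ') (hf : Function.Injective f) : IsPlanarGraph Γ := by
  obtain ⟨D⟩ := h
  have hE : Function.Injective f.mapEdgeSet := SimpleGraph.Hom.mapEdgeSet.injective f hf
  exact ⟨{
    point := D.point ∘ f
    point_injective := D.point_injective.comp hf
    arc := fun e => D.arc (f.mapEdgeSet e)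
    arc_continuous := fun e => D.arc_continuous _
    arc_injective := fun e => D.arc_injective _
    arc_ends := fun e => by
      rw [D.arc_ends, ← Sym2.map_map]; rfl
    arc_ne_point := fun e t h0 h1 v => D.arc_ne_point _ t h0 h1 _
    arc_ne_arc := fun e e' t t' hne h0 h1 => D.arc_ne_arc _ _ t t' (hE.ne hne) h0 h1 }⟩

/-- The triangular bipyramid: the complete graph on `{0, 1, 2, 3, 4}` without the edge `34`. -/
def bipyramid : SimpleGraph (Fin 5) where
  Adj i j := i ≠ j ∧ (i < 3 ∨ j < 3)
  symm := ⟨fun _ _ h => ⟨h.1.symm, h.2.symm⟩⟩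
  loopless := ⟨fun _ h => h.1 rfl⟩

/-- A straight-line drawing from coordinates. -/
theorem isPlanarGraph_of_segments {V : Type u} [LinearOrder V] {Γ : SimpleGraph V} (x y : V → ℝ)
    (hinj : ∀ v w, x v = x w → y v = y w → v = w)
    (hv : ∀ a b v, a < b → Γ.Adj a b → ∀ t : ℝ, 0 < t → t < 1 →
      x a + t * (x b - x a) = x v → y a + t * (y b - y a) = y v → False)
    (he : ∀ a b c d, a < b → c < d → Γ.Adj a b → Γ.Adj c d → (a = c → b = d → False) →
      ∀ s t : ℝ, 0 < s → s < 1 → 0 ≤ t → t ≤ 1 →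
      x a + s * (x b - x a) = x c + t * (x d - x c) →
      y a + s * (y b - y a) = y c + t * (y d - y c) → False) : IsPlanarGraph Γ := by
  -- The linear order gives each unordered edge a canonical orientation, from `inf` to `sup`.
  have hlt : ∀ e : Γ.edgeSet, (e : Sym2 V).inf < (e : Sym2 V).sup ∧
      Γ.Adj (e : Sym2 V).inf (e : Sym2 V).sup ∧ s((e : Sym2 V).inf, (e : Sym2 V).sup) = e := by
    rintro ⟨e, h⟩
    induction e with | _ a b =>
    have h : Γ.Adj a b := h
    rcases lt_or_gt_of_ne h.ne with hab | hab
    · simpa [hab.le] using ⟨hab, h⟩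
    · simpa [hab.le, Sym2.eq_swap] using ⟨hab, h.symm⟩
  refine ⟨{
    point := fun v => !₂[x v, y v]
    point_injective := fun v w h => ?_
    arc := fun e t => !₂[x (e : Sym2 V).inf + t * (x (e : Sym2 V).sup - x (e : Sym2 V).inf),
      y (e : Sym2 V).inf + t * (y (e : Sym2 V).sup - y (e : Sym2 V).inf)]
    arc_continuous := fun e => by fun_prop
    arc_injective := fun e s t h => ?_
    arc_ends := fun e => ?_
    arc_ne_point := fun e t h0 h1 v h => ?_
    arc_ne_arc := fun e e' s t hne h0 h1 h => ?_ }⟩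
  · have h0 := congrArg (fun z => z 0) h
    have h1 := congrArg (fun z => z 1) h
    exact hinj v w (by simpa using h0) (by simpa using h1)
  · have h0 := congrArg (fun z => z 0) h
    have h1 := congrArg (fun z => z 1) h
    simp at h0 h1
    rcases h0 with h0 | h0
    · exact Subtype.ext h0
    rcases h1 with h1 | h1
    · exact Subtype.ext h1
    exact absurd (hinj _ _ (sub_eq_zero.1 h0) (sub_eq_zero.1 h1)) (hlt e).1.ne'
  · conv_rhs => rw [← (hlt e).2.2]
    simp
  · have h2 := congrArg (fun z => z 0) h
    have h3 := congrArg (fun z => z 1) h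
    exact hv _ _ v (hlt e).1 (hlt e).2.1 t h0 h1 (by simpa using h2) (by simpa using h3)
  · have h2 := congrArg (fun z => z 0) h
    have h3 := congrArg (fun z => z 1) h
    refine he _ _ _ _ (hlt e).1 (hlt e').1 (hlt e).2.1 (hlt e').2.1 (fun p q => hne ?_) s t h0 h1
      t.2.1 t.2.2 (by simpa using h2) (by simpa using h3)
    apply Subtype.ext
    rw [← (hlt e).2.2, ← (hlt e').2.2, p, q]

/-- One apex, `(0,1)`, lies inside the triangle; the other, `(0,9)`, lies outside, high enough to
see all three corners. -/
theorem isPlanarGraph_bipyramid : IsPlanarGraph bipyramid := by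
  refine isPlanarGraph_of_segments ![-3, 3, 0, 0, 0] ![0, 0, 3, 1, 9] ?_ ?_ ?_
  · intro v w
    fin_cases v <;> fin_cases w <;> norm_num
  · intro a b v hab h t h0 h1
    fin_cases a <;> fin_cases b <;> first | (exfalso; revert hab; decide) |
      (exfalso; revert h; simp [bipyramid]; done) | skip
    all_goals
      clear hab h
      fin_cases v <;> simp <;> intros <;> first | linarith | grind
  · intro a b c d hab hcd h h' hne s t hs0 hs1 ht0 ht1
    fin_cases a <;> fin_cases b <;> first | (exfalso; revert hab; decide) |
      (exfalso; revert h; simp [bipyramid]; done) | skip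
    all_goals
      fin_cases c <;> fin_cases d <;> first | (exfalso; revert hcd; decide) |
        (exfalso; revert h'; simp [bipyramid]; done) | (exfalso; exact hne rfl rfl) | skip
      all_goals
        clear hab hcd h h' hne
        simp
        intros
        linarith

/-! ### Pairs generating non-members. -/

open scoped commutatorElement

namespace FiniteGroupClass

variable {F : FiniteGroupClass.{u}} {G : Type u} [Group G]

theorem mem_of_le (hher : F.IsHereditary) {H K : Subgroup G} (hHK : H ≤ K) (hK : F.Mem K) :
    F.Mem H :=
  F.mem_of_mulEquiv _ _ ⟨Subgroup.subgroupOfEquivOfLe hHK⟩ (hher K (H.subgroupOf K) hK)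

theorem mem_map (hform : F.IsFormation) {K : Type u} [Group K] (f : G →* K) {H : Subgroup G}
    (hH : F.Mem H) : F.Mem (H.map f) :=
  hform.mem_of_surjective _ _ (f.subgroupMap H) (f.subgroupMap_surjective H) hH

/-- The two elements generate a subgroup outside the class. -/
def NonMem (F : FiniteGroupClass.{u}) {G : Type u} [Group G] (g h : G) : Prop :=
  ¬ F.Mem (Subgroup.closure ({g, h} : Set G))

theorem NonMem.symm {g h : G} (hgh : F.NonMem g h) : F.NonMem h g := by
  unfold NonMem; rwa [Set.pair_comm]

/-- The source of almost all adjacencies: it suffices to recover a known bad pair from the new one.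
-/
theorem NonMem.mono (hher : F.IsHereditary) {g h a b : G} (hgh : F.NonMem g h)
    (hg : g ∈ Subgroup.closure ({a, b} : Set G)) (hh : h ∈ Subgroup.closure ({a, b} : Set G)) :
    F.NonMem a b := fun hab => hgh <| mem_of_le hher
      ((Subgroup.closure_le _).2 (by rintro x (rfl | rfl) <;> assumption)) hab

theorem NonMem.of_map (hform : F.IsFormation) {K : Type u} [Group K] (f : G →* K) {g h : G}
    (hgh : F.NonMem (f g) (f h)) : F.NonMem g h := by
  intro hm
  have := mem_map hform f hm
  rw [MonoidHom.map_closure, Set.image_pair] at this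
  exact hgh this

theorem NonMem.not_mem_isolated {g h : G} (hgh : F.NonMem g h) (hne : g ≠ h) :
    g ∉ F.isolated G := fun hg => hg (w := h) ⟨hne, hgh⟩

theorem exists_nonMem {g : G} (hg : g ∉ F.isolated G) :
    ∃ h, F.NonMem g h := by
  by_contra! hc
  exact hg fun h hh => hc h hh.2

end FiniteGroupClass

theorem Subgroup.commute_of_mem_closure_pair {G : Type*} [Group G] {a b x y : G} (hab : Commute a b)
    (hx : x ∈ Subgroup.closure ({a, b} : Set G)) (hy : y ∈ Subgroup.closure ({a, b} : Set G)) :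
    Commute x y := by
  have h1 : Subgroup.closure ({a, b} : Set G) ≤ Subgroup.centralizer {a, b} := by
    rw [Subgroup.closure_le]
    rintro z (rfl | rfl) <;> rw [SetLike.mem_coe, Subgroup.mem_centralizer_iff] <;>
      rintro w (rfl | rfl) <;> first | rfl | exact hab.eq | exact hab.symm.eq
  have h2 : Subgroup.closure ({a, b} : Set G) ≤
      Subgroup.centralizer (Subgroup.closure ({a, b} : Set G)) := by
    rw [Subgroup.closure_le]
    intro z hz
    rw [SetLike.mem_coe, Subgroup.mem_centralizer_iff]
    intro w hw
    exact (Subgroup.mem_centralizer_iff.1 (h1 hw) z hz).symm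
  exact Subgroup.mem_centralizer_iff.1 (h2 hy) x hx

/-- A group generated by two elements whose commutator is central is nilpotent. -/
theorem Group.isNilpotent_closure_pair {G : Type*} [Group G] {g h : G}
    (hg : Commute ⁅g, h⁆ g) (hh : Commute ⁅g, h⁆ h) :
    Group.IsNilpotent (Subgroup.closure ({g, h} : Set G)) := by
  set H := Subgroup.closure ({g, h} : Set G)
  let a : H := ⟨g, Subgroup.subset_closure (by simp)⟩
  let b : H := ⟨h, Subgroup.subset_closure (by simp)⟩
  have htop : Subgroup.closure ({a, b} : Set H) = ⊤ := by
    apply Subgroup.map_injective H.subtype_injective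
    rw [MonoidHom.map_closure, Set.image_pair, ← MonoidHom.range_eq_map, Subgroup.range_subtype]
    rfl
  have hc : ⁅a, b⁆ ∈ Subgroup.center H := by
    have : Subgroup.closure ({a, b} : Set H) ≤ Subgroup.centralizer {⁅a, b⁆} := by
      rw [Subgroup.closure_le]
      rintro z (rfl | rfl) <;> rw [SetLike.mem_coe, Subgroup.mem_centralizer_singleton_iff] <;>
        apply Subtype.ext
      exacts [hg.eq.symm, hh.eq.symm]
    rw [Subgroup.mem_center_iff]
    intro z
    exact Subgroup.mem_centralizer_singleton_iff.1 (this (htop ▸ Subgroup.mem_top z))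
  -- Modulo the centre the two generators commute, so the quotient is abelian.
  let f := QuotientGroup.mk' (Subgroup.center H)
  have hfc : Commute (f a) (f b) := by
    rw [← commutatorElement_eq_one_iff_commute, ← map_commutatorElement]
    exact (QuotientGroup.eq_one_iff _).2 hc
  have hQ : ∀ x y : H ⧸ Subgroup.center H, x * y = y * x := by
    have : Subgroup.closure ({f a, f b} : Set (H ⧸ Subgroup.center H)) = ⊤ := by
      rw [← Set.image_pair, ← MonoidHom.map_closure, htop, ← MonoidHom.range_eq_map,
        MonoidHom.range_eq_top]
      exact QuotientGroup.mk'_surjective _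
    intro x y
    exact Subgroup.commute_of_mem_closure_pair hfc (this ▸ Subgroup.mem_top _)
      (this ▸ Subgroup.mem_top _)
  have : Group.IsNilpotent (H ⧸ Subgroup.center H) := by
    let : CommGroup (H ⧸ Subgroup.center H) := { mul_comm := hQ }
    infer_instance
  exact Subgroup.isNilpotent_of_ker_le_center f (by rw [QuotientGroup.ker_mk'])

namespace FiniteGroupClass

variable {F : FiniteGroupClass.{u}} {G : Type u} [Group G] [Finite G]

theorem NonMem.not_central_commutator (hnil : F.ContainsNilpotent) {g h : G} (hgh : F.NonMem g h)
    (h1 : Commute ⁅g, h⁆ g) (h2 : Commute ⁅g, h⁆ h) : False :=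
  hgh (hnil _ (Group.isNilpotent_closure_pair h1 h2))

theorem NonMem.not_commute (hnil : F.ContainsNilpotent) {g h : G} (hgh : F.NonMem g h) :
    g * h ≠ h * g := fun hc => by
  have := commutatorElement_eq_one_iff_mul_comm.2 hc
  exact hgh.not_central_commutator hnil (by rw [this]; exact Commute.one_left _)
    (by rw [this]; exact Commute.one_left _)

theorem NonMem.ne (hnil : F.ContainsNilpotent) {g h : G} (hgh : F.NonMem g h) : g ≠ h := by
  rintro rfl; exact hgh.not_commute hnil rfl

/-- Bad pairs are automatically distinct and non-isolated, so distinctness has to be supplied only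
within each side. -/
theorem not_threeThree_of_planar (hnil : F.ContainsNilpotent) (hpl : IsPlanarGraph (F.nonGraph G))
    (a₀ a₁ a₂ b₀ b₁ b₂ : G) (ha₀₁ : a₀ ≠ a₁) (ha₀₂ : a₀ ≠ a₂) (ha₁₂ : a₁ ≠ a₂)
    (hb₀₁ : b₀ ≠ b₁) (hb₀₂ : b₀ ≠ b₂) (hb₁₂ : b₁ ≠ b₂)
    (h₀₀ : F.NonMem a₀ b₀) (h₀₁ : F.NonMem a₀ b₁) (h₀₂ : F.NonMem a₀ b₂)
    (h₁₀ : F.NonMem a₁ b₀) (h₁₁ : F.NonMem a₁ b₁) (h₁₂ : F.NonMem a₁ b₂)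
    (h₂₀ : F.NonMem a₂ b₀) (h₂₁ : F.NonMem a₂ b₁) (h₂₂ : F.NonMem a₂ b₂) : False := by
  have hab : ∀ i j, F.NonMem (![a₀, a₁, a₂] i) (![b₀, b₁, b₂] j) := by
    intro i j; fin_cases i <;> fin_cases j <;> assumption
  have hinj : ∀ x y z : G, x ≠ y → x ≠ z → y ≠ z → Function.Injective ![x, y, z] := by
    intro x y z h1 h2 h3 i j h
    fin_cases i <;> fin_cases j <;> simp_all
  refine hpl.not_threeThree
    (fun i => ⟨![a₀, a₁, a₂] i, (hab i 0).not_mem_isolated ((hab i 0).ne hnil)⟩)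
    (fun j => ⟨![b₀, b₁, b₂] j, (hab 0 j).symm.not_mem_isolated ((hab 0 j).ne hnil).symm⟩)
    (fun i j h => hinj _ _ _ ha₀₁ ha₀₂ ha₁₂ (Subtype.ext_iff.1 h))
    (fun i j h => hinj _ _ _ hb₀₁ hb₀₂ hb₁₂ (Subtype.ext_iff.1 h))
    (fun i j => ⟨(hab i j).ne hnil, hab i j⟩)

/-- In a planar non-`F` graph every vertex that is not an involution is inverted by its
neighbours. -/
theorem NonMem.inverts (hher : F.IsHereditary) (hnil : F.ContainsNilpotent)
    (hpl : IsPlanarGraph (F.nonGraph G)) {g h : G} (hgh : F.NonMem g h) (hg : g * g ≠ 1) :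
    h * g = g⁻¹ * h := by
  have hc := hgh.not_commute hnil
  by_contra hinv
  have hgi : g⁻¹ ≠ g := fun h => hg (by nth_rw 1 [← h]; simp)
  have c1 : ∀ a b : G, a ∈ Subgroup.closure ({a, b} : Set G) := fun a b =>
    Subgroup.subset_closure (by simp)
  have c2 : ∀ a b : G, b ∈ Subgroup.closure ({a, b} : Set G) := fun a b =>
    Subgroup.subset_closure (by simp)
  have left : ∀ {H : Subgroup G} {x y : G}, x ∈ H → x * y ∈ H → y ∈ H := fun {H} _ _ hx =>
    (H.mul_mem_cancel_left hx).1
  have right : ∀ {H : Subgroup G} {x y : G}, x ∈ H → y * x ∈ H → y ∈ H := fun {H} _ _ hx =>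
    (H.mul_mem_cancel_right hx).1
  have inv : ∀ {H : Subgroup G} {x : G}, x⁻¹ ∈ H → x ∈ H := fun {H} _ hx => inv_mem_iff.1 hx
  -- Any element of `{g, g⁻¹, h}` together with any of `{gh, hg, g⁻¹h}` generates `⟨g, h⟩`. The
  -- negated claim is what separates `hg` from `g⁻¹h`.
  refine not_threeThree_of_planar hnil hpl g g⁻¹ h (g * h) (h * g) (g⁻¹ * h) hgi.symm
    (hgh.ne hnil) ?_ hc ?_ (fun h => hinv h)
    (hgh.mono hher (c1 _ _) (left (c1 _ _) (c2 _ _)))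
    (hgh.mono hher (c1 _ _) (right (c1 _ _) (c2 _ _)))
    (hgh.mono hher (c1 _ _) (left (inv_mem (c1 _ _)) (c2 _ _)))
    (hgh.mono hher (inv (c1 _ _)) (left (inv (c1 _ _)) (c2 _ _)))
    (hgh.mono hher (inv (c1 _ _)) (right (inv (c1 _ _)) (c2 _ _)))
    (hgh.mono hher (inv (c1 _ _)) (left (c1 _ _) (c2 _ _)))
    (hgh.mono hher (right (c1 _ _) (c2 _ _)) (c1 _ _))
    (hgh.mono hher (left (c1 _ _) (c2 _ _)) (c1 _ _))
    (hgh.mono hher (inv (right (c1 _ _) (c2 _ _))) (c1 _ _))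
  · rintro rfl; simp at hc
  · intro h; exact hgi (mul_right_cancel h).symm

end FiniteGroupClass

/-! ### Dihedral groups. -/

/-- `s` is a reflection with respect to the rotation `r`. -/
structure IsReflection {G : Type*} [Group G] (r s : G) : Prop where
  mul_self : s * s = 1
  swap : s * r = r⁻¹ * s

namespace IsReflection

variable {G : Type*} [Group G] {r s : G}

theorem swap_inv (h : IsReflection r s) : s * r⁻¹ = r * s := by
  rw [mul_inv_eq_iff_eq_mul, mul_assoc, h.swap, mul_inv_cancel_left]

theorem inv_eq (h : IsReflection r s) : s⁻¹ = s := inv_eq_of_mul_eq_one_left h.mul_self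

theorem rotate (h : IsReflection r s) : IsReflection r (r * s) where
  mul_self := by rw [mul_assoc, ← mul_assoc s, h.swap, mul_assoc, mul_inv_cancel_left, h.mul_self]
  swap := by rw [mul_assoc, h.swap, mul_inv_cancel_left, inv_mul_cancel_left]

theorem pow (h : IsReflection r s) (n : ℕ) : IsReflection (r ^ n) s where
  mul_self := h.mul_self
  swap := by
    induction n with
    | zero => simp
    | succ n ih => rw [pow_succ, ← mul_assoc, ih, mul_assoc, h.swap, mul_inv_rev, ← mul_assoc,
        ← mul_inv_rev, ← mul_inv_rev, pow_mul_comm']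

/-- Elements of a dihedral group are rotations or reflections. -/
theorem mem_closure (h : IsReflection r s) {x : G}
    (hx : x ∈ Subgroup.closure ({r, s} : Set G)) : ∃ i : ℤ, x = r ^ i ∨ x = r ^ i * s := by
  have sz : ∀ i : ℤ, s * r ^ i = r ^ (-i) * s := by
    intro i
    have : SemiconjBy s r r⁻¹ := h.swap
    simpa using (this.zpow_right i).eq
  induction hx using Subgroup.closure_induction with
  | mem x hx =>
    rcases hx with rfl | rfl
    · exact ⟨1, Or.inl (by simp)⟩
    · exact ⟨0, Or.inr (by simp)⟩
  | one => exact ⟨0, Or.inl (by simp)⟩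
  | mul x y _ _ hx hy =>
    obtain ⟨i, rfl | rfl⟩ := hx <;> obtain ⟨j, rfl | rfl⟩ := hy
    · exact ⟨i + j, Or.inl (by rw [zpow_add])⟩
    · exact ⟨i + j, Or.inr (by rw [zpow_add, mul_assoc])⟩
    · exact ⟨i - j, Or.inr (by rw [mul_assoc, sz, sub_eq_add_neg, zpow_add, mul_assoc])⟩
    · exact ⟨i - j, Or.inl (by
        rw [mul_assoc, ← mul_assoc s, sz, mul_assoc, h.mul_self, mul_one, sub_eq_add_neg,
          zpow_add])⟩
  | inv x _ hx =>
    obtain ⟨i, rfl | rfl⟩ := hx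
    · exact ⟨-i, Or.inl (by rw [zpow_neg])⟩
    · exact ⟨i, Or.inr (by rw [mul_inv_rev, h.inv_eq, ← zpow_neg, sz, neg_neg])⟩

/-- The embedding of the dihedral group of order 6 given by a rotation of order 3 and a
reflection. -/
theorem exists_dihedralThree (h : IsReflection r s) (hr : r ≠ 1) (hr3 : r * (r * r) = 1)
    (hs : s ≠ 1) : ∃ e : DihedralGroup 3 →* G, Function.Injective e ∧
      e.range = Subgroup.closure ({r, s} : Set G) := by
  have hri : r⁻¹ = r * r := inv_eq_of_mul_eq_one_right hr3
  have e1 : s * r = r * (r * s) := by rw [h.swap, hri, mul_assoc]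
  have e2 : ∀ x, s * (r * x) = r * (r * (s * x)) := fun x => by
    rw [← mul_assoc, e1]; simp only [mul_assoc]
  have e3 : ∀ x, s * (s * x) = x := fun x => by rw [← mul_assoc, h.mul_self, one_mul]
  have e4 : ∀ x, r * (r * (r * x)) = x := fun x => by
    have := congrArg (· * x) hr3
    simpa only [mul_assoc, one_mul] using this
  let f : DihedralGroup 3 → G
    | .r i => r ^ i.val
    | .sr i => s * r ^ i.val
  have v0 : (0 : ZMod 3).val = 0 := rfl
  have v1 : (1 : ZMod 3).val = 1 := rfl
  have v2 : (2 : ZMod 3).val = 2 := rfl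
  have hf : ∀ x y, f (x * y) = f x * f y := by
    have z : ∀ i : ZMod 3, i = 0 ∨ i = 1 ∨ i = 2 := by decide
    have a11 : (1 : ZMod 3) + 1 = 2 := rfl
    have a12 : (1 : ZMod 3) + 2 = 0 := rfl
    have a21 : (2 : ZMod 3) + 1 = 0 := rfl
    have a22 : (2 : ZMod 3) + 2 = 1 := rfl
    have b01 : (0 : ZMod 3) - 1 = 2 := rfl
    have b02 : (0 : ZMod 3) - 2 = 1 := rfl
    have b12 : (1 : ZMod 3) - 2 = 2 := rfl
    have b21 : (2 : ZMod 3) - 1 = 1 := rfl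
    rintro (i | i) (j | j) <;> rcases z i with rfl | rfl | rfl <;> rcases z j with rfl | rfl | rfl <;>
      simp only [f, DihedralGroup.r_mul_r, DihedralGroup.r_mul_sr, DihedralGroup.sr_mul_r,
        DihedralGroup.sr_mul_sr, a11, a12, a21, a22, b01, b02, b12, b21, v0, v1, v2, add_zero,
        zero_add, sub_zero, sub_self, pow_zero, pow_one, pow_two, mul_one, one_mul, mul_assoc, e1,
        e2, e4, h.mul_self, hr3]
  refine ⟨MonoidHom.mk' f hf, ?_, le_antisymm ?_ ?_⟩
  · have hr2 : r * r ≠ 1 := fun h2 => hr (by rw [h2, mul_one] at hr3; exact hr3)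
    -- Otherwise `s` would be a power of `r` and commute with it, forcing `r = 1`.
    have hns : ∀ i : ℕ, s * r ^ i ≠ 1 := by
      intro i hi
      have hsr : s = (r ^ i)⁻¹ := eq_inv_of_mul_eq_one_left hi
      have hc : s * r = r * s := by
        rw [hsr]; exact ((Commute.refl r).pow_left i).inv_left.eq
      rw [e1] at hc
      exact hr (mul_eq_right.1 (mul_left_cancel hc))
    rw [injective_iff_map_eq_one]
    rintro (i | i) hi
    · change r ^ i.val = 1 at hi
      fin_cases i
      · rfl
      · exact absurd (by simpa [ZMod.val] using hi) hr
      · exact absurd (by simpa [ZMod.val, pow_two] using hi) hr2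
    · exact absurd hi (hns _)
  · rintro _ ⟨x, rfl⟩
    have hrm : r ∈ Subgroup.closure ({r, s} : Set G) := Subgroup.subset_closure (by simp)
    have hsm : s ∈ Subgroup.closure ({r, s} : Set G) := Subgroup.subset_closure (by simp)
    rcases x with i | i
    · exact pow_mem hrm _
    · exact mul_mem hsm (pow_mem hrm _)
  · rw [Subgroup.closure_le]
    rintro x (rfl | rfl)
    · exact ⟨.r 1, by simp [f, v1]⟩
    · exact ⟨.sr 0, by simp [f, v0]⟩

end IsReflection

theorem nonempty_dihedralGroup_three_mulEquiv_perm :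
    Nonempty (DihedralGroup 3 ≃* Equiv.Perm (Fin 3)) := by
  obtain ⟨e, he, -⟩ := IsReflection.exists_dihedralThree (r := finRotate 3)
    (s := Equiv.swap (0 : Fin 3) 1) ⟨by decide, by decide⟩ (by decide) (by decide) (by decide)
  refine ⟨MulEquiv.ofBijective e ((Fintype.bijective_iff_injective_and_card e).2 ⟨he, ?_⟩)⟩
  rw [DihedralGroup.card, Fintype.card_perm]; rfl

theorem Subgroup.left_mem_closure_pair {G : Type*} [Group G] (a b : G) :
    a ∈ Subgroup.closure ({a, b} : Set G) := Subgroup.subset_closure (by simp)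

theorem Subgroup.right_mem_closure_pair {G : Type*} [Group G] (a b : G) :
    b ∈ Subgroup.closure ({a, b} : Set G) := Subgroup.subset_closure (by simp)

open Subgroup (left_mem_closure_pair right_mem_closure_pair)

theorem zpow_of_cube_eq_one {G : Type*} [Group G] {r : G} (hr : r * (r * r) = 1) (i : ℤ) :
    r ^ i = 1 ∨ r ^ i = r ∨ r ^ i = r⁻¹ := by
  have h3 : r ^ (3 : ℤ) = 1 := by
    rw [show (3 : ℤ) = 1 + (1 + 1) from rfl, zpow_add, zpow_add, zpow_one, hr]
  have key : ∀ c : ℤ, (∃ q, i = 3 * q + c) → r ^ i = r ^ c := by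
    rintro c ⟨q, rfl⟩
    rw [zpow_add, zpow_mul, h3, one_zpow, one_mul]
  have : (∃ q, i = 3 * q + 0) ∨ (∃ q, i = 3 * q + 1) ∨ (∃ q, i = 3 * q + -1) := by
    have : i = 3 * (i / 3) + 0 ∨ i = 3 * (i / 3) + 1 ∨ i = 3 * (i / 3 + 1) + -1 := by omega
    rcases this with h | h | h
    exacts [Or.inl ⟨_, h⟩, Or.inr (Or.inl ⟨_, h⟩), Or.inr (Or.inr ⟨_, h⟩)]
  rcases this with h | h | h
  · exact Or.inl (by rw [key _ h, zpow_zero])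
  · exact Or.inr (Or.inl (by rw [key _ h, zpow_one]))
  · exact Or.inr (Or.inr (by rw [key _ h, zpow_neg_one]))

/-! ### Rotations in non-members have order 3. -/

namespace FiniteGroupClass

variable {F : FiniteGroupClass.{u}} {G : Type u} [Group G]

/-- A subgroup of a central product of members is a member. -/
theorem mem_of_le_sup_of_commute (hform : F.IsFormation) (hher : F.IsHereditary)
    {A B H : Subgroup G} (hA : F.Mem A) (hB : F.Mem B) (hc : ∀ a ∈ A, ∀ b ∈ B, Commute a b)
    (hH : H ≤ A ⊔ B) : F.Mem H := by
  have hprod : F.Mem (A × B) := F.mem_of_mulEquiv _ _ ⟨Subgroup.topEquiv⟩ <|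
    hform.mem_subdirect A B ⊤ hA hB (fun a => ⟨⟨(a, 1), trivial⟩, rfl⟩)
      (fun b => ⟨⟨(1, b), trivial⟩, rfl⟩)
  let f : A × B →* G := A.subtype.noncommCoprod B.subtype fun a b => hc a a.2 b b.2
  have hf : F.Mem f.range :=
    hform.mem_of_surjective _ _ f.rangeRestrict f.rangeRestrict_surjective hprod
  refine mem_of_le hher ?_ hf
  have hrange : f.range = A ⊔ B := by
    simpa using MonoidHom.noncommCoprod_range A.subtype B.subtype fun a b => hc a a.2 b b.2
  rwa [hrange]

section

variable [Finite G]

/-- In a dihedral group of order `4m` with `m` odd, the subgroup of index 2 generated by the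
square of the rotation detects membership. -/
theorem NonMem.sq_rotation (hform : F.IsFormation) (hher : F.IsHereditary)
    (hnil : F.ContainsNilpotent) {r s : G} (hrs : IsReflection r s) (h : F.NonMem r s) {k : ℕ}
    (hr : r ^ (2 * (2 * k + 1)) = 1) : F.NonMem (r * r) s := by
  intro hm
  -- `z` is central in `⟨r, s⟩` with `z² = 1`, and `r = (r²)⁻ᵏ z`. So `⟨r, s⟩` lies in the central
  -- product of `⟨r², s⟩` and `⟨z⟩`.
  set z := r ^ (2 * k + 1) with hz
  have hzz : z * z = 1 := by rw [hz, ← pow_add, ← two_mul]; exact hr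
  have hzr : Commute r z := (Commute.refl r).pow_right _
  have hzs : Commute s z := by
    have := (hrs.pow (2 * k + 1)).swap
    rw [← hz, inv_eq_of_mul_eq_one_left hzz] at this
    exact this
  have hB : F.Mem (Subgroup.zpowers z) := by
    have := hnil _ (Group.isNilpotent_closure_pair (g := z) (h := z) (by simp) (by simp))
    rwa [Set.pair_eq_singleton, ← Subgroup.zpowers_eq_closure] at this
  refine h (mem_of_le_sup_of_commute hform hher hm hB ?_ ?_)
  · intro a ha b hb
    obtain ⟨j, rfl⟩ := Subgroup.mem_zpowers_iff.1 hb
    have : Subgroup.closure ({r * r, s} : Set G) ≤ Subgroup.centralizer {z} := by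
      rw [Subgroup.closure_le]
      rintro x (rfl | rfl) <;> rw [SetLike.mem_coe, Subgroup.mem_centralizer_singleton_iff]
      exacts [(hzr.mul_left hzr).eq, hzs.eq]
    have hc : Commute a z := Subgroup.mem_centralizer_singleton_iff.1 (this ha)
    exact hc.zpow_right j
  · rw [Subgroup.closure_le]
    have hsA := right_mem_closure_pair (r * r) s
    have hrA := left_mem_closure_pair (r * r) s
    rintro x (rfl | rfl)
    · have : x = ((x * x) ^ k)⁻¹ * z := by
        rw [hz, ← pow_two, ← pow_mul, pow_succ, inv_mul_cancel_left]
      have hx := Subgroup.mul_mem_sup (inv_mem (pow_mem hrA k)) (Subgroup.mem_zpowers z)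
      rwa [← this] at hx
    · exact Subgroup.mem_sup_left hsA

/-- Otherwise the commutator `⁅r, s⁆ = r²` would be its own inverse, hence central in `⟨r, s⟩`. -/
theorem NonMem.rotation_pow_four_ne_one (hnil : F.ContainsNilpotent) {r s : G}
    (hrs : IsReflection r s) (h : F.NonMem r s) : r ^ 4 ≠ 1 := by
  intro h4
  have hc : ⁅r, s⁆ = r * r := by
    rw [commutatorElement_def, mul_assoc r, hrs.swap_inv, ← mul_assoc, mul_inv_cancel_right]
  have hinv : (r ^ 2)⁻¹ = r ^ 2 := inv_eq_of_mul_eq_one_left (by rw [← pow_add]; exact h4)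
  refine h.not_central_commutator hnil ?_ ?_ <;> rw [hc, ← pow_two]
  · exact (Commute.refl r).pow_left 2
  · have := (hrs.pow 2).swap
    rw [hinv] at this
    exact this.symm

/-- Let `n` be the order of `r`. For `n` odd, `r²` generates `⟨r⟩`; for `n ≡ 2` mod 4, `r²` works by
`NonMem.sq_rotation`; for `4 ∣ n`, the power `r ^ (n/2 + 1)` generates `⟨r⟩` and differs from `r⁻¹`
because `n ≠ 4`. -/
theorem NonMem.exists_third_rotation (hform : F.IsFormation) (hher : F.IsHereditary)
    (hnil : F.ContainsNilpotent) {r s : G} (hrs : IsReflection r s) (h : F.NonMem r s) :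
    r * (r * r) = 1 ∨ ∃ x, x ≠ r ∧ x ≠ r⁻¹ ∧
      ∀ t, IsReflection r t → F.NonMem r t → F.NonMem x t := by
  have hn : 0 < orderOf r := orderOf_pos r
  have hr1 : r ≠ 1 := by
    rintro rfl; exact h.not_commute hnil (by simp)
  have hgen : ∀ (x t : G), r ∈ Subgroup.zpowers x → F.NonMem r t → F.NonMem x t := by
    intro x t hx ht
    refine ht.mono hher ?_ (right_mem_closure_pair x t)
    exact (Subgroup.zpowers_le.2 (left_mem_closure_pair x t)) hx
  by_cases h3 : r * (r * r) = 1
  · exact Or.inl h3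
  refine Or.inr ?_
  have hsq : r * r ≠ r ∧ r * r ≠ r⁻¹ :=
    ⟨fun h => hr1 (mul_eq_left.1 h), fun h => h3 (by rw [h, mul_inv_cancel])⟩
  have hcases : (∃ k, orderOf r = 2 * k + 1) ∨ (∃ k, orderOf r = 2 * (2 * k + 1)) ∨
      ∃ k, orderOf r = 4 * k := by
    have : orderOf r = 2 * (orderOf r / 2) + 1 ∨ orderOf r = 2 * (2 * (orderOf r / 4) + 1) ∨
        orderOf r = 4 * (orderOf r / 4) := by omega
    rcases this with h | h | h
    exacts [Or.inl ⟨_, h⟩, Or.inr (Or.inl ⟨_, h⟩), Or.inr (Or.inr ⟨_, h⟩)]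
  rcases hcases with ⟨k, hk⟩ | ⟨k, hk⟩ | ⟨k, hk⟩
  · refine ⟨r * r, hsq.1, hsq.2, fun t _ ht => hgen _ _ ?_ ht⟩
    have : (r * r) ^ (k + 1) = r := by
      rw [← pow_two, ← pow_mul, show 2 * (k + 1) = 2 * k + 1 + 1 by ring, ← hk, pow_succ,
        pow_orderOf_eq_one, one_mul]
    rw [Subgroup.mem_zpowers_iff]
    exact ⟨(k + 1 : ℕ), by rw [zpow_natCast, this]⟩
  · exact ⟨r * r, hsq.1, hsq.2, fun t hrt ht =>
      ht.sq_rotation hform hher hnil hrt (hk ▸ pow_orderOf_eq_one r)⟩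
  · have hne : ∀ m, 0 < m → m < 4 * k → r ^ m ≠ 1 := fun m hm hmk =>
      pow_ne_one_of_lt_orderOf hm.ne' (hk ▸ hmk)
    have hk1 : k ≠ 1 := by
      rintro rfl
      exact h.rotation_pow_four_ne_one hnil hrs (by simpa [hk] using pow_orderOf_eq_one r)
    refine ⟨r ^ (2 * k + 1), fun he => ?_, fun he => ?_, fun t _ ht => hgen _ _ ?_ ht⟩
    · rw [pow_succ] at he
      exact hne (2 * k) (by omega) (by omega) (mul_eq_right.1 he)
    · refine hne (2 * k + 2) (by omega) (by omega) ?_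
      rw [pow_succ, he, inv_mul_cancel]
    · have : (r ^ (2 * k + 1)) ^ (2 * k + 1) = r := by
        rw [← pow_mul, show (2 * k + 1) * (2 * k + 1) = 4 * k * (k + 1) + 1 by ring, pow_succ,
          pow_mul, ← hk, pow_orderOf_eq_one, one_pow, one_mul]
      rw [Subgroup.mem_zpowers_iff]
      exact ⟨(2 * k + 1 : ℕ), by rw [zpow_natCast, this]⟩

/-- Otherwise the rotations `r, r⁻¹, x` and the reflections `s, rs, r²s` form a `K₃,₃`. -/
theorem NonMem.rotation_cube (hform : F.IsFormation) (hher : F.IsHereditary)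
    (hnil : F.ContainsNilpotent) (hpl : IsPlanarGraph (F.nonGraph G)) {r s : G}
    (hrs : IsReflection r s) (h : F.NonMem r s) : r * (r * r) = 1 := by
  rcases h.exists_third_rotation hform hher hnil hrs with h3 | ⟨x, hx, hxi, hxt⟩
  · exact h3
  exfalso
  have hrr : r * r ≠ 1 := fun hrr => h.not_commute hnil
    (by rw [hrs.swap, inv_eq_of_mul_eq_one_left hrr])
  have hr1 : r ≠ 1 := by
    rintro rfl; simp at hrr
  have rot : ∀ t, F.NonMem r t → F.NonMem r (r * t) := fun t ht =>
    ht.mono hher (left_mem_closure_pair _ _)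
      ((Subgroup.mul_mem_cancel_left _ (left_mem_closure_pair _ _)).1 (right_mem_closure_pair _ _))
  have inv : ∀ t, F.NonMem r t → F.NonMem r⁻¹ t := fun t ht =>
    ht.mono hher (inv_mem_iff.1 (left_mem_closure_pair _ _)) (right_mem_closure_pair _ _)
  have t1 := rot s h
  have t2 := rot _ t1
  refine not_threeThree_of_planar hnil hpl r r⁻¹ x s (r * s) (r * (r * s))
    (fun he => hrr (by nth_rw 2 [he]; simp)) hx.symm hxi.symm ?_ ?_ ?_ h t1 t2 (inv _ h) (inv _ t1)
    (inv _ t2) (hxt _ hrs h) (hxt _ hrs.rotate t1) (hxt _ hrs.rotate.rotate t2)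
  · intro he; exact hr1 (mul_eq_right.1 he.symm)
  · intro he; rw [← mul_assoc] at he; exact hrr (mul_eq_right.1 he.symm)
  · intro he; exact hr1 (mul_eq_right.1 he.symm)

/-- If `h² ≠ 1` as well, `g` and `h` invert each other, as in the quaternion group. Then `g² = h² =
⁅g, h⁆` is central in `⟨g, h⟩`. -/
theorem NonMem.isReflection (hher : F.IsHereditary) (hnil : F.ContainsNilpotent)
    (hpl : IsPlanarGraph (F.nonGraph G)) {g h : G} (hgh : F.NonMem g h) (hg : g * g ≠ 1) :
    IsReflection g h := by
  have h1 := hgh.inverts hher hnil hpl hg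
  refine ⟨by_contra fun hh => ?_, h1⟩
  have h2 := hgh.symm.inverts hher hnil hpl hh
  have e1 : g * (h * g) = h := by rw [h1, mul_inv_cancel_left]
  have e2 : h * (g * h) = g := by rw [h2, mul_inv_cancel_left]
  have e3 : g * g = h * h := by
    nth_rw 2 [← e2]
    rw [← mul_assoc h g h, ← mul_assoc, e1]
  have e4 : ⁅g, h⁆ = g * g := by
    rw [commutatorElement_def, mul_inv_eq_iff_eq_mul, mul_inv_eq_iff_eq_mul, mul_assoc, mul_assoc,
      e1]
  refine hgh.not_central_commutator hnil ?_ ?_ <;> rw [e4]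
  · exact (Commute.refl g).mul_left (Commute.refl g)
  · rw [e3]; exact (Commute.refl h).mul_left (Commute.refl h)

/-- The rotation is `gh` if `h` is an involution too, and `h` itself otherwise. -/
theorem NonMem.exists_rotation (hher : F.IsHereditary) (hnil : F.ContainsNilpotent)
    (hpl : IsPlanarGraph (F.nonGraph G)) {g h : G} (hgh : F.NonMem g h) (hg : g * g = 1) :
    ∃ r, IsReflection r g ∧ F.NonMem r g := by
  by_cases hh : h * h = 1
  · refine ⟨g * h, ⟨hg, ?_⟩, hgh.mono hher (right_mem_closure_pair _ _)
      ((Subgroup.mul_mem_cancel_left _ (right_mem_closure_pair _ _)).1 (left_mem_closure_pair _ _))⟩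
    rw [← mul_assoc, hg, one_mul, mul_inv_rev, mul_assoc, inv_mul_cancel, mul_one,
      inv_eq_of_mul_eq_one_left hh]
  · exact ⟨h, hgh.symm.isReflection hher hnil hpl hh, hgh.symm⟩

theorem NonMem.sq_or_cube (hform : F.IsFormation) (hher : F.IsHereditary)
    (hnil : F.ContainsNilpotent) (hpl : IsPlanarGraph (F.nonGraph G)) {g h : G}
    (hgh : F.NonMem g h) : g * g = 1 ∨ g * (g * g) = 1 := by
  by_cases hg : g * g = 1
  · exact Or.inl hg
  · exact Or.inr (hgh.rotation_cube hform hher hnil hpl (hgh.isReflection hher hnil hpl hg))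

theorem NonMem.exists_rotation_reflection (hher : F.IsHereditary) (hnil : F.ContainsNilpotent)
    (hpl : IsPlanarGraph (F.nonGraph G)) {g h : G} (hgh : F.NonMem g h) :
    ∃ r s : G, IsReflection r s ∧ F.NonMem r s := by
  by_cases hg : g * g = 1
  · obtain ⟨r, hr, hn⟩ := hgh.exists_rotation hher hnil hpl hg
    exact ⟨r, g, hr, hn⟩
  · exact ⟨g, h, hgh.isReflection hher hnil hpl hg, hgh⟩

/-! ### The subgroup of isolated vertices is trivial. -/

theorem normal_of_coe_eq_isolated (hform : F.IsFormation) (hnil : F.ContainsNilpotent)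
    {N : Subgroup G} (hN : (N : Set G) = F.isolated G) : N.Normal := by
  have hmem : ∀ x, x ∈ N ↔ x ∈ F.isolated G := fun x => by rw [← hN]; rfl
  refine ⟨fun n hn g => ?_⟩
  rw [hmem] at hn ⊢
  by_contra hc
  obtain ⟨h, hh⟩ := exists_nonMem hc
  have hh' : F.NonMem ((MulAut.conj g).toMonoidHom n)
      ((MulAut.conj g).toMonoidHom (g⁻¹ * h * g)) := by
    have e : g * (g⁻¹ * h * g) * g⁻¹ = h := by group
    simpa [MulAut.conj_apply, e] using hh
  have := hh'.of_map hform
  exact this.not_mem_isolated (this.ne hnil) hn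

/-- Modulo the isolated vertices, a dihedral group of order 6 outside the class stays outside. -/
theorem NonMem.map_mk_isolated (hher : F.IsHereditary) (hnil : F.ContainsNilpotent)
    {N : Subgroup G} [N.Normal] (hN : (N : Set G) = F.isolated G) {r s : G}
    (hrs : IsReflection r s) (hr3 : r * (r * r) = 1) (h : F.NonMem r s) :
    F.NonMem (QuotientGroup.mk' N r) (QuotientGroup.mk' N s) := by
  intro hm
  set f := QuotientGroup.mk' N
  set S := Subgroup.closure ({r, s} : Set G) with hS
  have hmap : S.map f = Subgroup.closure {f r, f s} := by
    rw [hS, MonoidHom.map_closure, Set.image_pair]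
  -- Every nontrivial element of `⟨r, s⟩` has a neighbour, so `⟨r, s⟩` meets `N` trivially.
  have hinj : Function.Injective (f.subgroupMap S) := by
    rw [injective_iff_map_eq_one]
    rintro ⟨x, hx⟩ hx1
    have hxN : x ∈ N := (QuotientGroup.eq_one_iff x).1 (congrArg Subtype.val hx1)
    have hxI : x ∈ F.isolated G := by rw [← hN]; exact hxN
    apply Subtype.ext
    change x = 1
    obtain ⟨i, rfl | rfl⟩ := hrs.mem_closure hx
    · rcases zpow_of_cube_eq_one hr3 i with hi | hi | hi
      · exact hi
      · rw [hi] at hxI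
        exact absurd hxI (h.not_mem_isolated (h.ne hnil))
      · have : F.NonMem r⁻¹ s :=
          h.mono hher (inv_mem_iff.1 (left_mem_closure_pair _ _)) (right_mem_closure_pair _ _)
        rw [hi] at hxI
        exact absurd hxI (this.not_mem_isolated (this.ne hnil))
    · have : F.NonMem (r ^ i * s) r := h.mono hher (right_mem_closure_pair _ _)
        ((Subgroup.mul_mem_cancel_left _ (zpow_mem (right_mem_closure_pair _ _) i)).1
          (left_mem_closure_pair _ _))
      exact absurd hxI (this.not_mem_isolated (this.ne hnil))
  rw [← hmap] at hm
  exact h (F.mem_of_mulEquiv _ _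
    ⟨(MulEquiv.ofBijective _ ⟨hinj, f.subgroupMap_surjective S⟩).symm⟩ hm)

/-- Adjacency can be tested modulo `N`, so it is unaffected by a factor `x` from `N`. If `x ≠ 1`,
then `r, r⁻¹, rx` and `s, rs, sx` form a `K₃,₃`. -/
theorem isolated_eq_bot_of_planar (hform : F.IsFormation) (hher : F.IsHereditary)
    (hnil : F.ContainsNilpotent) (hpl : IsPlanarGraph (F.nonGraph G))
    {N : Subgroup G} (hN : (N : Set G) = F.isolated G) {r s : G}
    (hrs : IsReflection r s) (h : F.NonMem r s) : N = ⊥ := by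
  have hr3 := h.rotation_cube hform hher hnil hpl hrs
  have := normal_of_coe_eq_isolated hform hnil hN
  rw [Subgroup.eq_bot_iff_forall]
  intro x hx
  by_contra hx1
  set f := QuotientGroup.mk' N
  have hfx : f x = 1 := (QuotientGroup.eq_one_iff x).2 hx
  have h0 : F.NonMem (f r) (f s) := h.map_mk_isolated hher hnil hN hrs hr3
  have h1 : F.NonMem (f r) (f (r * s)) := by
    rw [map_mul]
    exact h0.mono hher (left_mem_closure_pair _ _)
      ((Subgroup.mul_mem_cancel_left _ (left_mem_closure_pair _ _)).1 (right_mem_closure_pair _ _))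
  have inv : ∀ y, F.NonMem (f r) y → F.NonMem (f r⁻¹) y := fun y hy => by
    rw [map_inv]
    exact hy.mono hher (inv_mem_iff.1 (left_mem_closure_pair _ _)) (right_mem_closure_pair _ _)
  have frx : f (r * x) = f r := by rw [map_mul, hfx, mul_one]
  have fsx : f (s * x) = f s := by rw [map_mul, hfx, mul_one]
  have hrN : r ∉ N := fun hr => h0.not_commute hnil (by
    rw [show f r = 1 from (QuotientGroup.eq_one_iff r).2 hr, one_mul, mul_one])
  have hri : r ≠ r⁻¹ := by
    intro he
    apply h.not_commute hnil
    rw [hrs.swap, ← he]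
  have hrri : r⁻¹ = r * r := inv_eq_of_mul_eq_one_right hr3
  refine not_threeThree_of_planar hnil hpl r r⁻¹ (r * x) s (r * s) (s * x) hri
    (fun he => hx1 (mul_eq_left.1 he.symm)) ?_ ?_ (fun he => hx1 (mul_eq_left.1 he.symm)) ?_
    (h0.of_map hform) (h1.of_map hform) ?_ ((inv _ h0).of_map hform) ((inv _ h1).of_map hform) ?_
    ?_ ?_ ?_
  · intro he
    rw [hrri] at he
    exact hrN (mul_left_cancel he ▸ hx)
  · intro he
    have : r = 1 := mul_eq_right.1 he.symm
    exact hrN (this ▸ N.one_mem)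
  · intro he
    rw [← hrs.swap_inv] at he
    exact hrN (inv_mem_iff.1 (mul_left_cancel he ▸ hx))
  all_goals apply NonMem.of_map hform f
  · rwa [fsx]
  · rw [fsx]; exact inv _ h0
  · rwa [frx]
  · rwa [frx]
  · rwa [frx, fsx]

/-- Both pairs generate a dihedral group of order 6, and the class is closed under isomorphism. -/
theorem NonMem.of_isReflection (hnil : F.ContainsNilpotent) {r s : G} (hrs : IsReflection r s)
    (hr3 : r * (r * r) = 1) (h : F.NonMem r s) {ρ t : G} (hρt : IsReflection ρ t) (hρ : ρ ≠ 1)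
    (hρ3 : ρ * (ρ * ρ) = 1) (ht : t ≠ 1) : F.NonMem ρ t := by
  have hr : r ≠ 1 := by rintro rfl; exact h.not_commute hnil (by simp)
  have hs : s ≠ 1 := by rintro rfl; exact h.not_commute hnil (by simp)
  obtain ⟨e, he, hre⟩ := hrs.exists_dihedralThree hr hr3 hs
  obtain ⟨e', he', hre'⟩ := hρt.exists_dihedralThree hρ hρ3 ht
  intro hm
  rw [← hre'] at hm
  refine h ?_
  rw [← hre]
  exact F.mem_of_mulEquiv _ _
    ⟨(MonoidHom.ofInjective he').symm.trans (MonoidHom.ofInjective he)⟩ hm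

end

end FiniteGroupClass

/-! ### Groups with element orders at most 3. -/

section ElementOrders

variable {G : Type*} [Group G]

/-- Otherwise `au` would have order 6. -/
theorem eq_one_or_eq_one_of_commute (hord : ∀ g : G, g * g = 1 ∨ g * (g * g) = 1) {a u : G}
    (ha : a * (a * a) = 1) (hu : u * u = 1) (hc : Commute a u) : a = 1 ∨ u = 1 := by
  have hsq : a * u * (a * u) = a * a := by
    rw [mul_assoc, ← mul_assoc u, ← hc.eq, mul_assoc a u, hu, mul_one]
  rcases hord (a * u) with h | h
  · rw [hsq] at h
    rw [h, mul_one] at ha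
    exact Or.inl ha
  · rw [hsq, hc.eq, mul_assoc, ha, mul_one] at h
    exact Or.inr h

/-- In a group with element orders at most 3, in which `s` inverts an element of order 3, no
further involution commutes with the involution `s`. -/
theorem not_commute_of_isReflection (hord : ∀ g : G, g * g = 1 ∨ g * (g * g) = 1) {r s t : G}
    (hrs : IsReflection r s) (hr : r ≠ 1) (hr3 : r * (r * r) = 1) (ht : t * t = 1) (ht1 : t ≠ 1)
    (hst : s ≠ t) : s * t ≠ t * s := by
  intro hc
  have hs := hrs.mul_self
  -- If `(tr)² = 1`, then `t` inverts `r` too, and `st` is an involution commuting with `r`. If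
  -- `(tr)³ = 1`, the elements behave as in `S₄`, where `s` times the conjugate `r⁻¹tr` is a 4-cycle
  -- with square `t`.
  rcases hord (t * r) with h | h
  · have htr : t * r = r⁻¹ * t := by
      rw [eq_inv_of_mul_eq_one_left h, mul_inv_rev, inv_eq_of_mul_eq_one_left ht]
    have hcomm : Commute r (s * t) := by
      rw [Commute, SemiconjBy, mul_assoc s, htr, ← mul_assoc, ← mul_assoc, hrs.swap_inv]
    have hstst : s * t * (s * t) = 1 := by
      nth_rw 1 [hc]
      rw [mul_assoc, ← mul_assoc s, hs, one_mul, ht]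
    rcases eq_one_or_eq_one_of_commute hord hr3 hstst hcomm with h1 | h1
    · exact hr h1
    · exact hst ((eq_inv_of_mul_eq_one_left h1).trans (inv_eq_of_mul_eq_one_left ht))
  · have e1 : r * (t * (r * (t * r))) = t := by
      rw [mul_assoc, mul_assoc, ← inv_eq_iff_mul_eq_one, inv_eq_of_mul_eq_one_left ht] at h
      exact h.symm
    set y := s * (r⁻¹ * (t * r)) with hy
    have hyy : y * y = t := by
      have e2 : ∀ x, r * (s * (r⁻¹ * x)) = s * (r * x) := fun x => by
        have e : r * s * r⁻¹ = s * r := by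
          rw [mul_assoc, hrs.swap_inv, ← mul_assoc, hrs.swap]
          rw [inv_eq_of_mul_eq_one_right hr3]
        simpa only [mul_assoc] using congrArg (· * x) e
      have e3 : ∀ x, s * (r⁻¹ * x) = r * (s * x) := fun x => by
        simpa only [mul_assoc] using congrArg (· * x) hrs.swap_inv
      have e4 : ∀ x, s * (t * (s * x)) = t * x := fun x => by
        rw [← mul_assoc s t, hc, mul_assoc, ← mul_assoc s, hs, one_mul]
      calc y * y = s * (r⁻¹ * (t * (r * (s * (r⁻¹ * (t * r)))))) := by simp only [hy, mul_assoc]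
        _ = r * (s * (t * (s * (r * (t * r))))) := by rw [e2, e3]
        _ = t := by rw [e4, e1]
    rcases hord y with h1 | h1
    · exact ht1 (hyy.symm.trans h1)
    · rw [hyy] at h1
      have : y = t := (eq_inv_of_mul_eq_one_left h1).trans (inv_eq_of_mul_eq_one_left ht)
      rw [this] at hyy
      exact ht1 (mul_eq_left.1 hyy)

end ElementOrders

/-! ### Identification of `G` with `S₃`. -/

namespace FiniteGroupClass

variable {F : FiniteGroupClass.{u}} {G : Type u} [Group G] [Finite G]

/-- Distinct involutions do not commute, so their product has order 3 and they generate a copy of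
`⟨r, s⟩`: all distinct involutions are adjacent. The three reflections in `⟨r, s⟩` and three
conjugates of an involution outside it would form a `K₃,₃`. -/
theorem closure_eq_top_of_planar (hform : F.IsFormation) (hher : F.IsHereditary)
    (hnil : F.ContainsNilpotent) (hpl : IsPlanarGraph (F.nonGraph G))
    (hiso : ∀ g : G, g ≠ 1 → ∃ h, F.NonMem g h) {r s : G}
    (hrs : IsReflection r s) (h : F.NonMem r s) :
    Subgroup.closure ({r, s} : Set G) = ⊤ := by
  have hord : ∀ g : G, g * g = 1 ∨ g * (g * g) = 1 := by
    intro g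
    by_cases hg : g = 1
    · simp [hg]
    · obtain ⟨x, hx⟩ := hiso g hg
      exact hx.sq_or_cube hform hher hnil hpl
  have hr3 := h.rotation_cube hform hher hnil hpl hrs
  have ne_one : ∀ {a b : G}, F.NonMem a b → a ≠ 1 := by
    rintro a b hab rfl; exact hab.not_commute hnil (by simp)
  have hcomm : ∀ a b : G, a * a = 1 → a ≠ 1 → b * b = 1 → b ≠ 1 → a ≠ b → a * b ≠ b * a := by
    intro a b ha ha1 hb hb1 hab
    obtain ⟨x, hx⟩ := hiso a ha1
    obtain ⟨ρ, hρ, hρa⟩ := hx.exists_rotation hher hnil hpl ha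
    exact not_commute_of_isReflection hord hρ (ne_one hρa)
      (hρa.rotation_cube hform hher hnil hpl hρ) hb hb1 hab
  have hadj : ∀ a b : G, a * a = 1 → a ≠ 1 → b * b = 1 → b ≠ 1 → a ≠ b → F.NonMem a b := by
    intro a b ha ha1 hb hb1 hab
    have hai := inv_eq_of_mul_eq_one_left ha
    have hbi := inv_eq_of_mul_eq_one_left hb
    have hne := hcomm a b ha ha1 hb hb1 hab
    have href : IsReflection (a * b) a := ⟨ha, by
      rw [mul_inv_rev, inv_mul_cancel_right, hbi, ← mul_assoc, ha, one_mul]⟩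
    have h3 : a * b * (a * b * (a * b)) = 1 := by
      refine (hord (a * b)).resolve_left fun h2 => hne ?_
      rw [eq_inv_of_mul_eq_one_left h2, mul_inv_rev, hai, hbi]
    have h1 : a * b ≠ 1 := fun h1 => hab ((eq_inv_of_mul_eq_one_left h1).trans hbi)
    exact (h.of_isReflection hnil hrs hr3 href h1 h3 ha1).mono hher
      (mul_mem (left_mem_closure_pair _ _) (right_mem_closure_pair _ _))
      (left_mem_closure_pair _ _)
  set S := Subgroup.closure ({r, s} : Set G)
  have hrS : r ∈ S := left_mem_closure_pair r s
  have hsS : s ∈ S := right_mem_closure_pair r s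
  have hr1 := ne_one h
  have hrr : r * r ≠ 1 := fun h => hr1 (by rw [h, mul_one] at hr3; exact hr3)
  have hs1 := ne_one h.symm
  have hinvol : ∀ t : G, t * t = 1 → t ∈ S := by
    intro t ht
    by_contra htS
    have ht1 : t ≠ 1 := fun h1 => htS (h1 ▸ S.one_mem)
    have hrs1 : r * s ≠ 1 := by
      intro he
      refine h.not_commute hnil ?_
      rw [eq_inv_of_mul_eq_one_left he, inv_mul_cancel, mul_inv_cancel]
    have hrrs1 : r * (r * s) ≠ 1 := by
      intro he
      refine h.not_commute hnil ?_
      have hsr : s = r := by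
        rw [← mul_assoc] at he
        have h1 := eq_inv_of_mul_eq_one_right he
        have h2 : (r * r)⁻¹ = r := by
          rw [mul_assoc r r r |>.symm] at hr3
          exact (eq_inv_of_mul_eq_one_right hr3).symm
        rw [h1, h2]
      rw [hsr]
    have hconj : ∀ a : G, a * a = 1 → a ∈ S → a * t * a * (a * t * a) = 1 ∧ a * t * a ∉ S := by
      intro a ha haS
      refine ⟨?_, fun hm => htS ?_⟩
      · calc a * t * a * (a * t * a) = a * t * (a * a) * t * a := by group
          _ = 1 := by rw [ha, mul_one, mul_assoc a, ht, mul_one, ha]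
      · exact (S.mul_mem_cancel_left haS).1 ((S.mul_mem_cancel_right haS).1 hm)
    have hrsS := S.mul_mem hrS hsS
    have c1 := hconj s hrs.mul_self hsS
    have c2 := hconj (r * s) hrs.rotate.mul_self hrsS
    have hmov : ∀ a : G, a * a = 1 → a ≠ 1 → a ∈ S → t ≠ a * t * a := by
      intro a ha ha1 haS he
      refine hcomm a t ha ha1 ht ht1 (fun h => htS (h ▸ haS)) ?_
      nth_rw 2 [he]
      rw [mul_assoc, ha, mul_one]
    have all : ∀ a b : G, a * a = 1 → a ≠ 1 → a ∈ S → b * b = 1 → b ∉ S → F.NonMem a b :=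
      fun a b ha ha1 haS hb hbS => hadj a b ha ha1 hb (fun h => hbS (h ▸ S.one_mem))
        (fun h => hbS (h ▸ haS))
    refine not_threeThree_of_planar hnil hpl s (r * s) (r * (r * s)) t (s * t * s)
      (r * s * t * (r * s)) ?_ ?_ ?_ (hmov s hrs.mul_self hs1 hsS)
      (hmov _ hrs.rotate.mul_self hrs1 hrsS) ?_ ?_ ?_ ?_ ?_ ?_ ?_ ?_ ?_ ?_
    · intro he; exact hr1 (mul_eq_right.1 he.symm)
    · intro he; rw [← mul_assoc] at he; exact hrr (mul_eq_right.1 he.symm)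
    · intro he; exact hr1 (mul_eq_right.1 he.symm)
    · intro he
      have hc : Commute r (s * t * s) := by
        -- The two conjugates of `t` differ by conjugation with `r`. If they agreed, `r` would
        -- commute with the involution `sts`.
        have e : r * s * t * (r * s) = r * (s * t * s) * r⁻¹ := by
          have : r * s * t * (r * s) = r * s * t * (s * r⁻¹) := by rw [hrs.swap_inv]
          rw [this]; simp only [mul_assoc]
        rw [e] at he
        exact (eq_mul_inv_iff_mul_eq.1 he).symm
      rcases eq_one_or_eq_one_of_commute hord hr3 c1.1 hc with h1 | h1
      · exact hr1 h1
      · exact c1.2 (h1 ▸ S.one_mem)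
    · exact all _ _ hrs.mul_self hs1 hsS ht htS
    · exact all _ _ hrs.mul_self hs1 hsS c1.1 c1.2
    · exact all _ _ hrs.mul_self hs1 hsS c2.1 c2.2
    · exact all _ _ hrs.rotate.mul_self hrs1 hrsS ht htS
    · exact all _ _ hrs.rotate.mul_self hrs1 hrsS c1.1 c1.2
    · exact all _ _ hrs.rotate.mul_self hrs1 hrsS c2.1 c2.2
    · exact all _ _ hrs.rotate.rotate.mul_self hrrs1 (S.mul_mem hrS hrsS) ht htS
    · exact all _ _ hrs.rotate.rotate.mul_self hrrs1 (S.mul_mem hrS hrsS) c1.1 c1.2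
    · exact all _ _ hrs.rotate.rotate.mul_self hrrs1 (S.mul_mem hrS hrsS) c2.1 c2.2
  rw [eq_top_iff]
  intro x _
  by_cases hxx : x * x = 1
  · exact hinvol x hxx
  -- A non-involution `x` is a product `(xy)y` of two involutions, both already in `S`.
  · obtain ⟨y, hy⟩ := hiso x (by rintro rfl; simp at hxx)
    have hxy := hy.isReflection hher hnil hpl hxx
    exact (S.mul_mem_cancel_right (hinvol y hxy.mul_self)).1 (hinvol _ hxy.rotate.mul_self)

theorem nonempty_mulEquiv_perm_of_planar (hform : F.IsFormation) (hher : F.IsHereditary)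
    (hrec : F.IsTwoRecognizable) (hsemi : F.IsSemiregular) (hnil : F.ContainsNilpotent)
    (hpl : IsPlanarGraph (F.nonGraph G)) (hG : ¬ F.Mem G) : Nonempty (G ≃* Equiv.Perm (Fin 3)) := by
  obtain ⟨a, b, hab⟩ : ∃ a b : G, F.NonMem a b := by
    by_contra! hc
    exact hG (hrec G fun a b => not_not.1 (hc a b))
  obtain ⟨r, s, hrs, h⟩ := NonMem.exists_rotation_reflection hher hnil hpl hab
  obtain ⟨N, hN⟩ := hsemi G
  have hbot := isolated_eq_bot_of_planar hform hher hnil hpl hN hrs h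
  have hiso : ∀ g : G, g ≠ 1 → ∃ h, F.NonMem g h := fun g hg => exists_nonMem (by
    rw [← hN, hbot]; simpa using hg)
  have htop := closure_eq_top_of_planar hform hher hnil hpl hiso hrs h
  obtain ⟨e, he, hre⟩ := hrs.exists_dihedralThree
    (by rintro rfl; exact h.not_commute hnil (by simp))
    (h.rotation_cube hform hher hnil hpl hrs) (by rintro rfl; exact h.not_commute hnil (by simp))
  rw [htop, MonoidHom.range_eq_top] at hre
  obtain ⟨e'⟩ := nonempty_dihedralGroup_three_mulEquiv_perm
  exact ⟨(MulEquiv.ofBijective e ⟨he, hre⟩).symm.trans e'⟩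

/-! ### The graph of `S₃` and the final equivalence. -/

/-- The labelling of the nonidentity permutations of three points by the vertices of the
bipyramid, the two 3-cycles being the apices. -/
def bipyramidLabel (σ : Equiv.Perm (Fin 3)) : Fin 5 :=
  if σ = Equiv.swap 0 1 then 0 else if σ = Equiv.swap 0 2 then 1 else
    if σ = Equiv.swap 1 2 then 2 else if σ = finRotate 3 then 3 else 4

theorem bipyramidLabel_injOn : ∀ σ τ : Equiv.Perm (Fin 3), σ ≠ 1 → τ ≠ 1 →
    bipyramidLabel σ = bipyramidLabel τ → σ = τ := by
  decide

/-- The only edge absent from the bipyramid joins the labels of the two 3-cycles, which commute. -/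
theorem bipyramidLabel_adj : ∀ σ τ : Equiv.Perm (Fin 3), σ * τ ≠ τ * σ →
    bipyramidLabel σ ≠ bipyramidLabel τ ∧ (bipyramidLabel σ < 3 ∨ bipyramidLabel τ < 3) := by
  decide

end FiniteGroupClass

open FiniteGroupClass in
theorem theorem1p6 (F : FiniteGroupClass.{u}) (hform : F.IsFormation)
    (hher : F.IsHereditary) (hrec : F.IsTwoRecognizable) (hsemi : F.IsSemiregular)
    (hnil : F.ContainsNilpotent) (G : Type u) [Group G] [Finite G] :
    IsPlanarGraph (F.nonGraph G) ↔ (F.Mem G ∨ Nonempty (G ≃* Equiv.Perm (Fin 3))) := by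
  refine ⟨fun hpl => or_iff_not_imp_left.2
    (nonempty_mulEquiv_perm_of_planar hform hher hrec hsemi hnil hpl), ?_⟩
  rintro (hG | ⟨⟨e⟩⟩)
  · have : IsEmpty ((F.isolated G)ᶜ : Set G) := ⟨fun g => by
      obtain ⟨h, hh⟩ := exists_nonMem g.2
      exact hh (hher G _ hG)⟩
    exact isPlanarGraph_bipyramid.of_injective_hom ⟨isEmptyElim, fun {a} => isEmptyElim a⟩
      fun a => isEmptyElim a
  · have hne : ∀ g : ((F.isolated G)ᶜ : Set G), e g ≠ 1 := by
      intro g hg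
      obtain ⟨h, hh⟩ := exists_nonMem g.2
      rw [EmbeddingLike.map_eq_one_iff] at hg
      exact hh.not_commute hnil (by simp [hg])
    -- Only an injective homomorphism is needed, so it does not matter whether `S₃` itself is a
    -- member.
    refine isPlanarGraph_bipyramid.of_injective_hom ⟨fun g => bipyramidLabel (e g), ?_⟩ ?_
    · intro g h hgh
      refine bipyramidLabel_adj _ _ fun hc => ?_
      rw [← map_mul, ← map_mul] at hc
      exact NonMem.not_commute hnil hgh.2 (e.injective hc)
    · intro g h hgh
      exact Subtype.ext (e.injective (bipyramidLabel_injOn _ _ (hne g) (hne h) hgh))
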